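/- Consider a synchronous system of $n\ge 2$ processes on a complete network with reliable point-to-point channels, up to $f$ of which may be Byzantine faulty. Each process $i$ has an input $v_i\in\mathbb R^d$, $d\ge 1$. Let $1\le p\le\infty$. For a finite multiset $I$ of points of $\mathbb R^d$ let $D_p(I)$ be the maximum of $\|x-y\|_p$ over pairs of members $x,y$ of $I$ (so $D_p(I)=0$ if $I$ has fewer than two members). Let $\delta$ be a real-valued function of finite multisets of points of $\mathbb R^d$ such that, for a constant $\kappa$ (which may depend on $n,f,d,p$ but not on $I$), $$0\le \delta(I)\le \kappa\, D_p(I)\qquad\text{for all } I .$$ A deterministic synchronous algorithm solves input-dependent $(\delta,p)$-relaxed exact Byzantine vector consensus if, for every set of at most $f$ faulty processes, every behaviour of the faulty processes and all inputs, with $I$ denoting the multiset of the inputs at the non-faulty processes: * (Termination) every non-faulty process decides on a vector after finitely many rounds; * (Agreement) all non-faulty processes decide on the same vector; * (Relaxed validity) the decision of each non-faulty process is within $L_p$-distance $\delta(I)$ of some point of the convex hull of $I$. If $n\le 3f$, then no deterministic synchronous algorithm solves input-dependent $(\delta,p)$-relaxed exact Byzantine vector consensus. -/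

import Mathlib

open scoped ENNReal

universe u v

namespace RelaxedBVC

/-- The `L_p` norm of a real vector with `d` coordinates (`1 ≤ p ≤ ∞`), through Mathlib's `PiLp`. -/
noncomputable def lpNorm {d : ℕ} (p : ℝ≥0∞) (w : Fin d → ℝ) : ℝ :=
  ‖(WithLp.toLp p w : PiLp p (fun _ : Fin d => ℝ))‖

/-- The `(δ, p)`-relaxed convex hull of `S`: all points at `L_p` distance at most `δ` from some
point of the convex hull of `S`. -/
def relaxedHull {d : ℕ} (p : ℝ≥0∞) (δ : ℝ) (S : Set (Fin d → ℝ)) : Set (Fin d → ℝ) :=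
  {y | ∃ z ∈ convexHull ℝ S, lpNorm p (y - z) ≤ δ}

/-- The largest `L_p` distance between two members of the multiset `I`
(it is `0` if `I` has fewer than two members). -/
noncomputable def maxEdge {d : ℕ} (p : ℝ≥0∞) (I : Multiset (Fin d → ℝ)) : ℝ :=
  ((I ×ˢ I).map fun e => lpNorm p (e.1 - e.2)).fold max 0

/-- A deterministic synchronous message-passing algorithm for `n` processes on the complete
network, with inputs and outputs in `V`. The processes may run different programs, and the
state spaces and the message alphabet are arbitrary. In each round every process sends to every
process a message determined by its current state (`none` means that no message is sent), and then
updates its state from the messages received, of which it knows the senders.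
A message of a process to itself carries nothing beyond its own state. -/
structure SyncAlgorithm (n : ℕ) (V : Type) where
  /-- state space of each process -/
  State : Fin n → Type u
  /-- message alphabet -/
  Msg : Type v
  /-- start state for a given input -/
  start : (i : Fin n) → V → State i
  /-- `send i s j` is what process `i` in state `s` sends to process `j` -/
  send : (i : Fin n) → State i → Fin n → Option Msg
  /-- `step i s m` is the next state of process `i` after it received `m j` from each process `j` -/
  step : (i : Fin n) → State i → (Fin n → Option Msg) → State i
  /-- the output announced in a state, if any -/
  output : (i : Fin n) → State i → Option V

namespace SyncAlgorithm

variable {n : ℕ} {V : Type} (A : SyncAlgorithm.{u, v} n V)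

/-- The states after `r` rounds when the processes in `F` are Byzantine: in round `r` a process
`j ∈ F` sends to each process `i` the arbitrary message `byz r j i`, while the processes outside
`F` follow the algorithm. (The states recorded for members of `F` influence nothing.) -/
def stateAt (F : Finset (Fin n)) (byz : ℕ → Fin n → Fin n → Option A.Msg) (x : Fin n → V) :
    ℕ → (i : Fin n) → A.State i
  | 0 => fun i => A.start i (x i)
  | r + 1 => fun i =>
      A.step i (stateAt F byz x r i) fun j =>
        if j ∈ F then byz r j i else A.send j (stateAt F byz x r j) i

/-- Process `i` decides `y` in the execution: `y` is the first output that it announces,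
and it announces it after finitely many rounds. -/
def Decides (F : Finset (Fin n)) (byz : ℕ → Fin n → Fin n → Option A.Msg) (x : Fin n → V)
    (i : Fin n) (y : V) : Prop :=
  ∃ r, A.output i (A.stateAt F byz x r i) = some y ∧
    ∀ s < r, A.output i (A.stateAt F byz x s i) = none

end SyncAlgorithm

/-- The multiset of the inputs at the non-faulty processes, where `F` is the set of faulty ones. -/
def nonfaultyInputs {n : ℕ} {V : Type} (F : Finset (Fin n)) (x : Fin n → V) : Multiset V :=
  (Fᶜ).val.map x

/-- `A` solves `(δ, p)`-relaxed exact Byzantine vector consensus among `n` processes of which up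
to `f` are Byzantine, where `δ` is a function of the inputs at the non-faulty processes:
termination, agreement and relaxed validity hold in every execution. -/
def Solves {n d : ℕ} (A : SyncAlgorithm.{u, v} n (Fin d → ℝ)) (f : ℕ) (p : ℝ≥0∞)
    (δ : Multiset (Fin d → ℝ) → ℝ) : Prop :=
  ∀ (F : Finset (Fin n)), F.card ≤ f →
  ∀ (byz : ℕ → Fin n → Fin n → Option A.Msg) (x : Fin n → Fin d → ℝ),
    (∀ i ∉ F, ∃ y, A.Decides F byz x i y) ∧
    (∀ i ∉ F, ∀ j ∉ F, ∀ y z, A.Decides F byz x i y → A.Decides F byz x j z → y = z) ∧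
    (∀ i ∉ F, ∀ y, A.Decides F byz x i y →
      y ∈ relaxedHull p (δ (nonfaultyInputs F x)) {w | w ∈ nonfaultyInputs F x})

end RelaxedBVC

namespace RelaxedBVC

/-! This is the hexagon argument. Equal non-faulty inputs have diameter `0`, so the tolerance
vanishes and the common input must be decided (`Solves.decides_of_forall_eq`). Split the processes
into three classes of at most `f` and run two crosswise-linked copies of the system, with inputs `1`
and `0`. By `stateAt_coverByz`, a faulty class can simulate the rest of the doubled system. With
class `1` faulty, class `0` in copy `true` decides `1`; with class `0` faulty, class `1` in copy
`false` decides `0`. With class `2` faulty, these two groups face each other in one execution and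
violate agreement. -/

theorem lpNorm_zero {d : ℕ} (p : ℝ≥0∞) (hp : 1 ≤ p) : lpNorm p (0 : Fin d → ℝ) = 0 := by
  have : Fact (1 ≤ p) := ⟨hp⟩
  simp [lpNorm]

theorem eq_zero_of_lpNorm_le_zero {d : ℕ} {p : ℝ≥0∞} (hp : 1 ≤ p) {w : Fin d → ℝ}
    (h : lpNorm p w ≤ 0) : w = 0 := by
  have : Fact (1 ≤ p) := ⟨hp⟩
  simpa [lpNorm] using norm_le_zero_iff.1 h

theorem fold_max_zero_of_forall_eq_zero (s : Multiset ℝ) (h : ∀ a ∈ s, a = 0) :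
    s.fold max 0 = 0 := by
  induction s using Multiset.induction_on with
  | empty => simp
  | cons a s ih =>
    rw [Multiset.fold_cons_left, ih fun b hb => h b (Multiset.mem_cons_of_mem hb),
      h a (Multiset.mem_cons_self a s), max_self]

theorem maxEdge_eq_zero_of_forall_eq {d : ℕ} {p : ℝ≥0∞} (hp : 1 ≤ p)
    {I : Multiset (Fin d → ℝ)} {v : Fin d → ℝ} (h : ∀ w ∈ I, w = v) : maxEdge p I = 0 := by
  refine fold_max_zero_of_forall_eq_zero _ fun a ha => ?_
  obtain ⟨⟨w, z⟩, hwz, rfl⟩ := Multiset.mem_map.1 ha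
  obtain ⟨hw, hz⟩ := Multiset.mem_product.1 hwz
  have e : w - z = 0 := by rw [h w hw, h z hz, sub_self]
  simpa [e] using lpNorm_zero p hp

/-- A relaxed hull with a nonpositive tolerance of a set contained in `{v}` is contained
in `{v}`. -/
theorem eq_of_mem_relaxedHull {d : ℕ} {p : ℝ≥0∞} (hp : 1 ≤ p) {ε : ℝ} (hε : ε ≤ 0)
    {S : Set (Fin d → ℝ)} {v y : Fin d → ℝ} (hS : S ⊆ {v}) (hy : y ∈ relaxedHull p ε S) :
    y = v := by
  obtain ⟨z, hz, hyz⟩ := hy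
  have hzv : z = v := by simpa using convexHull_mono hS hz
  rw [← hzv]
  exact sub_eq_zero.1 (eq_zero_of_lpNorm_le_zero hp (hyz.trans hε))

namespace SyncAlgorithm

variable {n : ℕ} {V : Type} (A : SyncAlgorithm.{u, v} n V)

/-- The failure-free execution of `A` on two copies of every process: copy `b` of each process
has input `x b`, and copy `b` of process `i` is connected to copy `nb b i j` of process `j`. -/
def coverState (nb : Bool → Fin n → Fin n → Bool) (x : Bool → V) :
    ℕ → Bool → (i : Fin n) → A.State i
  | 0 => fun b i => A.start i (x b)
  | r + 1 => fun b i =>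
      A.step i (coverState nb x r b i) fun j => A.send j (coverState nb x r (nb b i j) j) i

/-- The messages by which faulty processes imitate the doubled system towards the copies
selected by `c`. -/
def coverByz (nb : Bool → Fin n → Fin n → Bool) (x : Bool → V) (c : Fin n → Bool) :
    ℕ → Fin n → Fin n → Option A.Msg :=
  fun r j i => A.send j (A.coverState nb x r (nb (c i) i j) j) i

/-- If the selection `c` respects the connections of the doubled system outside `F`, then the
processes outside `F` cannot distinguish the original system from the doubled one. -/
theorem stateAt_coverByz {nb : Bool → Fin n → Fin n → Bool} (x : Bool → V) {c : Fin n → Bool}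
    {F : Finset (Fin n)} (h : ∀ i ∉ F, ∀ j ∉ F, nb (c i) i j = c j) (r : ℕ) :
    ∀ i ∉ F, A.stateAt F (A.coverByz nb x c) (fun i => x (c i)) r i
      = A.coverState nb x r (c i) i := by
  induction r with
  | zero => intro i _; rfl
  | succ r ih =>
    intro i hi
    simp only [stateAt, coverState]
    rw [ih i hi]
    congr 1
    funext j
    split_ifs with hj
    · rfl
    · rw [ih j hj, h i hi j hj]

/-- The right side involves `c` only through `c i` and not `F`, so a decision carries over between
executions with different faulty sets that select the same copy of `i`. -/
theorem decides_coverByz_iff {nb : Bool → Fin n → Fin n → Bool} (x : Bool → V) {c : Fin n → Bool}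
    {F : Finset (Fin n)} (h : ∀ i ∉ F, ∀ j ∉ F, nb (c i) i j = c j) {i : Fin n} (hi : i ∉ F)
    (y : V) :
    A.Decides F (A.coverByz nb x c) (fun i => x (c i)) i y ↔
      ∃ r, A.output i (A.coverState nb x r (c i) i) = some y ∧
        ∀ s < r, A.output i (A.coverState nb x s (c i) i) = none := by
  simp only [Decides, A.stateAt_coverByz x h _ i hi]

end SyncAlgorithm

/-- When all non-faulty inputs equal `v`, every non-faulty process decides `v`. -/
theorem Solves.decides_of_forall_eq {n d f : ℕ} {A : SyncAlgorithm.{u, v} n (Fin d → ℝ)}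
    {p : ℝ≥0∞} {κ : ℝ} {δ : Multiset (Fin d → ℝ) → ℝ} (hA : Solves A f p δ) (hp : 1 ≤ p)
    (hδ : ∀ I, δ I ≤ κ * maxEdge p I) {F : Finset (Fin n)} (hF : F.card ≤ f)
    (byz : ℕ → Fin n → Fin n → Option A.Msg) {x : Fin n → Fin d → ℝ} {w : Fin d → ℝ}
    (hx : ∀ i ∉ F, x i = w) {i : Fin n} (hi : i ∉ F) : A.Decides F byz x i w := by
  obtain ⟨hterm, -, hval⟩ := hA F hF byz x
  obtain ⟨y, hy⟩ := hterm i hi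
  have hI : ∀ z ∈ nonfaultyInputs F x, z = w := by
    intro z hz
    obtain ⟨j, hj, rfl⟩ := Multiset.mem_map.1 hz
    exact hx j (Finset.mem_compl.1 hj)
  have hε : δ (nonfaultyInputs F x) ≤ 0 := by
    simpa [maxEdge_eq_zero_of_forall_eq hp hI] using hδ (nonfaultyInputs F x)
  have hyw : y = w := eq_of_mem_relaxedHull hp hε hI (hval i hi y hy)
  exact hyw ▸ hy

/-- The processes with index congruent to `k` modulo `3`. -/
def residueClass (n k : ℕ) : Finset (Fin n) := {i | i.val % 3 = k}

theorem mem_residueClass {n k : ℕ} {i : Fin n} : i ∈ residueClass n k ↔ i.val % 3 = k := by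
  simp [residueClass]

theorem card_residueClass_le {n f k : ℕ} (hnf : n ≤ 3 * f) : (residueClass n k).card ≤ f := by
  have h : (residueClass n k).card ≤ (Finset.range f).card := by
    -- Within one class the remainder is fixed, so the quotient determines the index.
    refine Finset.card_le_card_of_injOn (fun i => i.val / 3) ?_ ?_
    · intro i _
      have := i.isLt
      simp only [Finset.coe_range, Set.mem_Iio]
      omega
    · intro i hi j hj hij
      have hi' := mem_residueClass.1 hi
      have hj' := mem_residueClass.1 hj
      simp only at hij
      exact Fin.ext (by omega)
  simpa using h

/-- The connections of the hexagon: only between the classes of `0` and `1` modulo `3` are the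
two copies exchanged. -/
def hexagonNeighbor {n : ℕ} (b : Bool) (i j : Fin n) : Bool :=
  if (i.val % 3 = 0 ∧ j.val % 3 = 1) ∨ (i.val % 3 = 1 ∧ j.val % 3 = 0) then !b else b

/-- A crossed link needs an end in each of the classes `0` and `1`, one of which is removed here. -/
theorem hexagonNeighbor_const {n k : ℕ} (hk : k < 2) (b : Bool) :
    ∀ i ∉ residueClass n k, ∀ j ∉ residueClass n k, hexagonNeighbor b i j = b := by
  intro i hi j hj
  rw [mem_residueClass] at hi hj
  exact if_neg (by omega)

theorem hexagonNeighbor_decide {n : ℕ} :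
    ∀ i ∉ residueClass n 2, ∀ j ∉ residueClass n 2,
      hexagonNeighbor (decide (i.val % 3 = 0)) i j = decide (j.val % 3 = 0) := by
  intro i hi j hj
  rw [mem_residueClass] at hi hj
  have hi' : i.val % 3 = 0 ∨ i.val % 3 = 1 := by omega
  have hj' : j.val % 3 = 0 ∨ j.val % 3 = 1 := by omega
  rcases hi' with hi' | hi' <;> rcases hj' with hj' | hj' <;> simp [hexagonNeighbor, hi', hj']

end RelaxedBVC

open RelaxedBVC in
theorem mainTheorem7 (n f d : ℕ) (hn : 2 ≤ n) (hnf : n ≤ 3 * f) (hd : 1 ≤ d)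
    (p : ℝ≥0∞) (hp : 1 ≤ p) (κ : ℝ) (δ : Multiset (Fin d → ℝ) → ℝ)
    (hδ_nonneg : ∀ I, 0 ≤ δ I) (hδ_le : ∀ I, δ I ≤ κ * RelaxedBVC.maxEdge p I) :
    ¬ ∃ A : RelaxedBVC.SyncAlgorithm.{u, v} n (Fin d → ℝ), RelaxedBVC.Solves A f p δ := by
  rintro ⟨A, hA⟩
  let x : Bool → Fin d → ℝ := fun b _ => if b then 1 else 0
  let c : Fin n → Bool := fun i => decide (i.val % 3 = 0)
  let a : Fin n := ⟨0, by omega⟩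
  let e : Fin n := ⟨1, by omega⟩
  have hcard : ∀ k, (residueClass n k).card ≤ f := fun _ => card_residueClass_le hnf
  have ha1 : a ∉ residueClass n 1 := by simp [mem_residueClass, a]
  have ha2 : a ∉ residueClass n 2 := by simp [mem_residueClass, a]
  have he0 : e ∉ residueClass n 0 := by simp [mem_residueClass, e]
  have he2 : e ∉ residueClass n 2 := by simp [mem_residueClass, e]
  -- The decision is forced with class `1` faulty, then moved through the doubled system to the
  -- mixed execution.
  have ha : A.Decides (residueClass n 2) (A.coverByz hexagonNeighbor x c) (fun i => x (c i)) a
      (x true) :=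
    (A.decides_coverByz_iff x hexagonNeighbor_decide ha2 _).2 <|
      (A.decides_coverByz_iff x (c := fun _ => true)
        (hexagonNeighbor_const (by norm_num) true) ha1 _).1 <|
        hA.decides_of_forall_eq hp hδ_le (hcard 1) _ (fun _ _ => rfl) ha1
  have he : A.Decides (residueClass n 2) (A.coverByz hexagonNeighbor x c) (fun i => x (c i)) e
      (x false) :=
    (A.decides_coverByz_iff x hexagonNeighbor_decide he2 _).2 <|
      (A.decides_coverByz_iff x (c := fun _ => false)
        (hexagonNeighbor_const (by norm_num) false) he0 _).1 <|
        hA.decides_of_forall_eq hp hδ_le (hcard 0) _ (fun _ _ => rfl) he0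
  have hagree := (hA _ (hcard 2) _ _).2.1 a ha2 e he2 _ _ ha he
  -- A coordinate exists as `1 ≤ d`; there agreement reads `1 = 0`.
  simpa [x] using congrFun hagree ⟨0, hd⟩
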